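/- **Theorem 3 (LMs Find TE Shortcuts).** A (deterministic) automaton is a triple $(\Sigma,\mathcal Q,\delta)$ with finite input alphabet $\Sigma$, finite nonempty state set $\mathcal Q$ and $\delta:\mathcal Q\times\Sigma\to\mathcal Q$; on an input $\sigma=(\sigma_1,\dots,\sigma_T)$ and initial state $q_0$ its state sequence is $q(q_0,\sigma)=(q_1,\dots,q_T)$ with $q_t=\delta(q_{t-1},\sigma_t)$. In a traffic-engineering (TE) automaton the states stand for configurations (split ratios), i.e. they are represented by vectors $\rho(q)\in\mathbb R^m$; a sequence $y\in\mathcal Q^T$ is then a vector $\rho(y)\in\mathbb R^{T\times m}$. No other property of TE automata is used: the statement is for every finite automaton and every $\rho$. A Transformer LM on sequences of length $T$ is $f_c\circ f_{mlp}^{(l)}\circ f_{attn}^{(l)}\circ\cdots\circ f_{mlp}^{(1)}\circ f_{attn}^{(1)}\circ \mathrm{PE}$, where $\mathrm{PE}$ adds a token embedding and a positional embedding (in $\mathbb R^D$), each $f_{attn}$ is causal (decoder-only) self-attention $\mathrm{softmax}(QK^\top/\sqrt{D_k})V$ with $Q=HW_Q$, $K=HW_K$, $V=HW_V$, query/key dimension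 $D_k$ and value dimension $D_v$, each $f_{mlp}$ is a position-wise ReLU network with one hidden layer of $W$ units mapping $\mathbb R^{D_v}$ to $\mathbb R^D$, and $f_c$ is a position-wise affine classifier giving one logit per state; the LM outputs at each position a state of maximal logit. There are an absolute constant $C$ and, for each $\epsilon\in(0,1)$, integers $S=S(\epsilon,T)\ge 1$ with $S=O_\epsilon(\log T)$ as $T\to\infty$, such that for every $T\ge1$ and every automaton $(\Sigma,\mathcal Q,\delta)$ there is a Transformer LM with $$D\le C|\mathcal Q|^2,\quad W\le C|\mathcal Q|^2,\quad D_k\le C|\mathcal Q|,\quad D_v\le C|\mathcal Q|,\quad \text{number of layers } l\le C\log T,$$ in which only the parameters of $f_c$ depend on the initial state $q_0$, with the following two properties. 1. For every $q_0$ and every input $\sigma\in\Sigma^T$, at every position $t$ the logit of $q_t$ is strictly larger than the logit of every other state; so the LM outputs exactly the state sequence $q(q_0,\sigma)$. 2. Let $\epsilon\in(0,1)$, $S=S(\epsilon,T)$, let $\rho:\mathcal Q\to\mathbb R^m$ be any representation of the states, let $R\in\mathbb R^{S\times (T\times m)}$ have independent $\mathcal N(0,1)$ entries, and let $f(u)=Ru/\sqrt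 S$ be the shortcut map. For any two pairs $(q_0,\sigma)$ and $(q_0',\sigma')$, write $y,y'$ for the LM's outputs and $q,q'$ for the automaton's state sequences. Then with probability at least $1-2/T^2$ over $R$ the LM simulates the automaton on both inputs, $y=q$ and $y'=q'$, and its compressed (shortcut) states satisfy $$(1-\epsilon)\,\|\rho(q)-\rho(q')\|_2^2\;\le\;\|f(\rho(y))-f(\rho(y'))\|_2^2\;\le\;(1+\epsilon)\,\|\rho(q)-\rho(q')\|_2^2 .$$ -/

import Mathlib

open scoped BigOperators

namespace TELM

noncomputable section

/-! Automata `(Γ, Q, δ)` with input alphabet `Γ`, state set `Q` and transition function `δ`. -/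

/-- The state reached after reading the first `t` symbols of `σ` from the initial state `q₀`. -/
def stateAfter {Γ Q : Type*} {T : ℕ} (δ : Q → Γ → Q) (q₀ : Q) (σ : Fin T → Γ) : ℕ → Q
  | 0 => q₀
  | t + 1 =>
      if h : t < T then δ (stateAfter δ q₀ σ t) (σ ⟨t, h⟩) else stateAfter δ q₀ σ t

/-- The state sequence `(q₁, …, q_T)` of the automaton on `(σ₁, …, σ_T)`, started in `q₀`. The
entry with (zero-based) index `t` is the state after `t + 1` symbols. -/
def stateSeq {Γ Q : Type*} {T : ℕ} (δ : Q → Γ → Q) (q₀ : Q) (σ : Fin T → Γ) (t : Fin T) : Q :=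
  stateAfter δ q₀ σ (t + 1)

/-! Decoder-only Transformers on sequences of length `T`. -/

/-- The weights of one Transformer layer (an attention block followed by an MLP block):
`D` is the embedding dimension, `Dk` the query and key dimension, `Dv` the value dimension, `W` the
number of hidden units of the MLP. -/
structure Layer (D Dk Dv W : ℕ) where
  /-- query projection -/
  wQ : Matrix (Fin D) (Fin Dk) ℝ
  /-- key projection -/
  wK : Matrix (Fin D) (Fin Dk) ℝ
  /-- value projection -/
  wV : Matrix (Fin D) (Fin Dv) ℝ
  /-- input weights of the MLP -/
  w₁ : Matrix (Fin Dv) (Fin W) ℝ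
  /-- hidden biases of the MLP -/
  b₁ : Fin W → ℝ
  /-- output weights of the MLP -/
  w₂ : Matrix (Fin W) (Fin D) ℝ
  /-- output biases of the MLP -/
  b₂ : Fin D → ℝ

/-- Row-wise softmax with the causal mask: position `t` attends to the positions `s ≤ t` only. -/
def causalSoftmax {T : ℕ} (A : Matrix (Fin T) (Fin T) ℝ) : Matrix (Fin T) (Fin T) ℝ :=
  Matrix.of fun t s =>
    if s ≤ t then Real.exp (A t s) / ∑ r ∈ Finset.Iic t, Real.exp (A t r) else 0

namespace Layer

variable {T D Dk Dv W : ℕ}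

/-- Self-attention `softmax (Q Kᵀ / √Dk) V` with `Q = H wQ`, `K = H wK`, `V = H wV`. -/
def attn (L : Layer D Dk Dv W) (H : Matrix (Fin T) (Fin D) ℝ) : Matrix (Fin T) (Fin Dv) ℝ :=
  causalSoftmax ((Real.sqrt (Dk : ℝ))⁻¹ • ((H * L.wQ) * (H * L.wK).transpose)) * (H * L.wV)

/-- The position-wise ReLU network with one hidden layer. -/
def mlp (L : Layer D Dk Dv W) (H : Matrix (Fin T) (Fin Dv) ℝ) : Matrix (Fin T) (Fin D) ℝ :=
  Matrix.of fun t i => (∑ k, max ((H * L.w₁) t k + L.b₁ k) 0 * L.w₂ k i) + L.b₂ i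

/-- The layer `f_mlp ∘ f_attn`. -/
def apply (L : Layer D Dk Dv W) (H : Matrix (Fin T) (Fin D) ℝ) : Matrix (Fin T) (Fin D) ℝ :=
  L.mlp (L.attn H)

end Layer

/-- A Transformer without its output layer, for input sequences of length `T` over `Γ`: token
embedding, positional embedding, and a list of layers of common dimensions. -/
structure Backbone (Γ : Type*) (T : ℕ) where
  /-- embedding dimension -/
  D : ℕ
  /-- query and key dimension -/
  Dk : ℕ
  /-- value dimension -/
  Dv : ℕ
  /-- number of hidden units of each MLP -/
  W : ℕ
  /-- token embedding -/
  embed : Γ → Fin D → ℝ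
  /-- positional embedding -/
  pos : Fin T → Fin D → ℝ
  /-- the layers, the first one is applied first -/
  layers : List (Layer D Dk Dv W)

/-- The output layer: position-wise affine logits indexed by the classes `Q`. -/
structure Classifier (D : ℕ) (Q : Type*) where
  /-- weights -/
  w : Matrix (Fin D) Q ℝ
  /-- biases -/
  b : Q → ℝ

/-- The number of layers. -/
def Backbone.depth {Γ : Type*} {T : ℕ} (M : Backbone Γ T) : ℕ := M.layers.length

/-- The last hidden sequence `f_mlp ∘ f_attn ∘ ⋯ ∘ f_mlp ∘ f_attn ∘ PE`. -/
def Backbone.hidden {Γ : Type*} {T : ℕ} (M : Backbone Γ T) (σ : Fin T → Γ) :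
    Matrix (Fin T) (Fin M.D) ℝ :=
  M.layers.foldl (fun H L => L.apply H) (Matrix.of fun t i => M.embed (σ t) i + M.pos t i)

/-- The logits of the language model with backbone `M` and output layer `c`. -/
def Backbone.logits {Γ Q : Type*} {T : ℕ} (M : Backbone Γ T) (c : Classifier M.D Q)
    (σ : Fin T → Γ) (t : Fin T) (q : Q) : ℝ :=
  (M.hidden σ * c.w) t q + c.b q

/-- The output sequence of the language model: at each position a class of maximal logit. -/
def Backbone.output {Γ Q : Type*} [Finite Q] [Nonempty Q] {T : ℕ} (M : Backbone Γ T)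
    (c : Classifier M.D Q) (σ : Fin T → Γ) (t : Fin T) : Q :=
  Classical.choose (Finite.exists_max (M.logits c σ t))

/-! Shortcut states: Gaussian random projection of state sequences. -/

/-- The vector in `ℝ^(T × m)` of a sequence of `T` states, when the states are represented by
vectors `ρ q` in `ℝ^m`. -/
def seqVector {Q : Type*} {T m : ℕ} (ρ : Q → Fin m → ℝ) (y : Fin T → Q) :
    EuclideanSpace ℝ (Fin T × Fin m) :=
  WithLp.toLp 2 fun j => ρ (y j.1) j.2

/-- The law of an `S × κ` matrix with independent standard normal entries. -/
def gaussianMatrix (S : ℕ) (κ : Type*) [Fintype κ] : MeasureTheory.Measure (Fin S → κ → ℝ) :=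
  MeasureTheory.Measure.pi fun _ =>
    MeasureTheory.Measure.pi fun _ => ProbabilityTheory.gaussianReal 0 1

/-- The shortcut map `u ↦ R u / √S`. -/
def shortcut {S : ℕ} {κ : Type*} [Fintype κ] (R : Fin S → κ → ℝ) (u : EuclideanSpace ℝ κ) :
    EuclideanSpace ℝ (Fin S) :=
  WithLp.toLp 2 fun i => (1 / Real.sqrt (S : ℝ)) * ∑ j, R i j * u j

end

end TELM

namespace TELM

open MeasureTheory ProbabilityTheory Real

lemma map_inner_pi_gaussianReal {κ : Type*} [Fintype κ] (u : EuclideanSpace ℝ κ) (hu : ‖u‖ = 1) :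
    (Measure.pi fun _ : κ => gaussianReal 0 1).map (fun x => ∑ j, x j * u j) =
      gaussianReal 0 1 := by
  have h : (fun x : κ → ℝ => ∑ j, x j * u j) = (innerSL ℝ u) ∘ (WithLp.toLp 2) := by
    ext x
    simp [PiLp.inner_apply]
  rw [h, ← Measure.map_map (by fun_prop) (by fun_prop), map_pi_eq_stdGaussian,
    IsGaussian.map_eq_gaussianReal, integral_strongDual_stdGaussian, variance_dual_stdGaussian,
    innerSL_apply_norm, hu]
  simp

lemma exp_mul_sq_mul_gaussianPDFReal (l x : ℝ) :
    gaussianPDFReal 0 1 x * exp (l * x ^ 2) = (√(2 * π))⁻¹ * exp (-(1 / 2 - l) * x ^ 2) := by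
  rw [gaussianPDFReal]
  simp only [NNReal.coe_one, mul_one, sub_zero]
  rw [mul_assoc, ← exp_add]
  congr 2
  ring

lemma integrable_exp_mul_sq_gaussianReal {l : ℝ} (hl : l < 1 / 2) :
    Integrable (fun x => exp (l * x ^ 2)) (gaussianReal 0 1) := by
  rw [gaussianReal_of_var_ne_zero _ one_ne_zero,
    integrable_withDensity_iff (by fun_prop) (by simp [gaussianPDF])]
  simp only [toReal_gaussianPDF]
  simp_rw [mul_comm _ (gaussianPDFReal _ _ _), exp_mul_sq_mul_gaussianPDFReal]
  exact (integrable_exp_neg_mul_sq (by linarith)).const_mul _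

lemma integral_exp_mul_sq_gaussianReal {l : ℝ} (hl : l < 1 / 2) :
    ∫ x, exp (l * x ^ 2) ∂(gaussianReal 0 1) = (√(1 - 2 * l))⁻¹ := by
  rw [integral_gaussianReal_eq_integral_smul one_ne_zero]
  simp_rw [smul_eq_mul, exp_mul_sq_mul_gaussianPDFReal]
  rw [integral_const_mul, integral_gaussian, ← sqrt_inv, ← sqrt_mul (by positivity), ← sqrt_inv]
  congr 1
  have : 1 - 2 * l ≠ 0 := by linarith
  have : 1 / 2 - l ≠ 0 := by intro h; apply this; linarith
  have := pi_ne_zero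
  field_simp

section GaussianMatrix

variable {κ : Type*} [Fintype κ] {u : EuclideanSpace ℝ κ}

instance (S : ℕ) : IsProbabilityMeasure (gaussianMatrix S κ) := by
  unfold gaussianMatrix; infer_instance

lemma integrable_exp_mul_sq_sum (hu : ‖u‖ = 1) {l : ℝ} (hl : l < 1 / 2) :
    Integrable (fun x : κ → ℝ => exp (l * (∑ j, x j * u j) ^ 2))
      (Measure.pi fun _ : κ => gaussianReal 0 1) := by
  have h := integrable_exp_mul_sq_gaussianReal hl
  rw [← map_inner_pi_gaussianReal u hu, integrable_map_measure (by fun_prop)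
    (Measurable.aemeasurable (by fun_prop))] at h
  exact h

lemma exp_mul_sum_sq {S : ℕ} (u : EuclideanSpace ℝ κ) (l : ℝ) (R : Fin S → κ → ℝ) :
    exp (l * ∑ i, (∑ j, R i j * u j) ^ 2) = ∏ i, exp (l * (∑ j, R i j * u j) ^ 2) := by
  rw [Finset.mul_sum, exp_sum]

lemma integrable_exp_mul_sum_sq (S : ℕ) (hu : ‖u‖ = 1) {l : ℝ} (hl : l < 1 / 2) :
    Integrable (fun R => exp (l * ∑ i, (∑ j, R i j * u j) ^ 2)) (gaussianMatrix S κ) := by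
  simp_rw [exp_mul_sum_sq]
  exact Integrable.fintype_prod fun _ => integrable_exp_mul_sq_sum hu hl

/-- The moment generating function of the chi-squared law. -/
lemma mgf_sum_sq (S : ℕ) (hu : ‖u‖ = 1) {l : ℝ} (hl : l < 1 / 2) :
    mgf (fun R => ∑ i, (∑ j, R i j * u j) ^ 2) (gaussianMatrix S κ) l =
      exp (-(S * log (1 - 2 * l) / 2)) := by
  unfold mgf gaussianMatrix
  simp_rw [exp_mul_sum_sq]
  rw [integral_fintype_prod_eq_prod (f := fun _ (x : κ → ℝ) => exp (l * (∑ j, x j * u j) ^ 2))]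
  have h := integral_exp_mul_sq_gaussianReal hl
  rw [← map_inner_pi_gaussianReal u hu, integral_map (Measurable.aemeasurable (by fun_prop))
    (by fun_prop)] at h
  simp only [h, Finset.prod_const, Finset.card_univ, Fintype.card_fin]
  have h1 : (√(1 - 2 * l))⁻¹ = exp (-(log (1 - 2 * l) / 2)) := by
    rw [exp_neg, ← log_sqrt (by linarith), exp_log (sqrt_pos.2 (by linarith))]
  rw [h1, ← exp_nat_mul]
  congr 1
  ring

/-- An exponential rate for both tails of the normalized chi-squared law. -/
noncomputable def chiSqRate (ε : ℝ) : ℝ :=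
  min ((ε - log (1 + ε)) / 2) ((-ε - log (1 - ε)) / 2)

lemma chiSqRate_pos {ε : ℝ} (h0 : 0 < ε) (h1 : ε < 1) : 0 < chiSqRate ε := by
  have ha := log_lt_sub_one_of_pos (x := 1 + ε) (by linarith) (by linarith)
  have hb := log_lt_sub_one_of_pos (x := 1 - ε) (by linarith) (by linarith)
  exact lt_min (by linarith) (by linarith)

lemma measureReal_sum_sq_ge_le (S : ℕ) (hu : ‖u‖ = 1) {ε : ℝ} (h0 : 0 < ε) :
    (gaussianMatrix S κ).real {R | (1 + ε) * S ≤ ∑ i, (∑ j, R i j * u j) ^ 2} ≤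
      exp (-(chiSqRate ε * S)) := by
  have hl : ε / (2 * (1 + ε)) < 1 / 2 := by
    rw [div_lt_div_iff₀ (by positivity) (by positivity)]; linarith
  refine (measure_ge_le_exp_mul_mgf _ (by positivity)
    (integrable_exp_mul_sum_sq S hu hl)).trans ?_
  rw [mgf_sum_sq S hu hl, ← exp_add, exp_le_exp]
  have h2 : 1 - 2 * (ε / (2 * (1 + ε))) = (1 + ε)⁻¹ := by field_simp; ring
  have h3 : -(ε / (2 * (1 + ε))) * ((1 + ε) * S) = -(ε / 2 * S) := by field_simp
  rw [h2, log_inv, h3]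
  have := mul_le_mul_of_nonneg_right
    (min_le_left ((ε - log (1 + ε)) / 2) ((-ε - log (1 - ε)) / 2)) (Nat.cast_nonneg (α := ℝ) S)
  unfold chiSqRate
  linarith

lemma measureReal_sum_sq_le_le (S : ℕ) (hu : ‖u‖ = 1) {ε : ℝ} (h0 : 0 < ε) (h1 : ε < 1) :
    (gaussianMatrix S κ).real {R | ∑ i, (∑ j, R i j * u j) ^ 2 ≤ (1 - ε) * S} ≤
      exp (-(chiSqRate ε * S)) := by
  have h1' : 0 < 1 - ε := by linarith
  have hp : 0 < ε / (2 * (1 - ε)) := by positivity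
  have hl : -(ε / (2 * (1 - ε))) < 1 / 2 := by linarith
  refine (measure_le_le_exp_mul_mgf _ (by linarith)
    (integrable_exp_mul_sum_sq S hu hl)).trans ?_
  rw [mgf_sum_sq S hu hl, ← exp_add, exp_le_exp]
  have h2 : 1 - 2 * -(ε / (2 * (1 - ε))) = (1 - ε)⁻¹ := by field_simp; ring
  have h3 : - -(ε / (2 * (1 - ε))) * ((1 - ε) * S) = ε / 2 * S := by field_simp
  rw [h2, log_inv, h3]
  have := mul_le_mul_of_nonneg_right
    (min_le_right ((ε - log (1 + ε)) / 2) ((-ε - log (1 - ε)) / 2)) (Nat.cast_nonneg (α := ℝ) S)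
  unfold chiSqRate
  linarith

lemma shortcut_sub {S : ℕ} (R : Fin S → κ → ℝ) (u v : EuclideanSpace ℝ κ) :
    shortcut R u - shortcut R v = shortcut R (u - v) := by
  ext i
  simp [shortcut, mul_sub, Finset.sum_sub_distrib]

lemma norm_shortcut_sq {S : ℕ} (R : Fin S → κ → ℝ) (u : EuclideanSpace ℝ κ) :
    ‖shortcut R u‖ ^ 2 = (∑ i, (∑ j, R i j * u j) ^ 2) / S := by
  rw [EuclideanSpace.real_norm_sq_eq]
  simp only [shortcut, mul_pow, ← Finset.mul_sum, div_pow, one_pow]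
  rw [Real.sq_sqrt (Nat.cast_nonneg S)]
  ring

/-- Concentration of the length of a vector under a Gaussian random projection. -/
lemma measureReal_norm_shortcut_ge {S : ℕ} (hS : 0 < S) (u : EuclideanSpace ℝ κ) {ε : ℝ}
    (h0 : 0 < ε) (h1 : ε < 1) :
    1 - 2 * exp (-(chiSqRate ε * S)) ≤ (gaussianMatrix S κ).real
      {R | (1 - ε) * ‖u‖ ^ 2 ≤ ‖shortcut R u‖ ^ 2 ∧
        ‖shortcut R u‖ ^ 2 ≤ (1 + ε) * ‖u‖ ^ 2} := by
  rcases eq_or_ne u 0 with rfl | hu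
  · have : ∀ R : Fin S → κ → ℝ, ‖shortcut R (0 : EuclideanSpace ℝ κ)‖ ^ 2 = 0 := by
      intro R; rw [norm_shortcut_sq]; simp
    simp only [this, norm_zero]
    simp only [ne_eq, OfNat.ofNat_ne_zero, not_false_eq_true, zero_pow, mul_zero, le_refl, and_self,
      Set.ofPred_true, probReal_univ, tsub_le_iff_right, le_add_iff_nonneg_right]
    positivity
  have hn : 0 < ‖u‖ := norm_pos_iff.2 hu
  set v : EuclideanSpace ℝ κ := ‖u‖⁻¹ • u with hv
  have hv1 : ‖v‖ = 1 := by rw [hv, norm_smul, norm_inv, norm_norm, inv_mul_cancel₀ hn.ne']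
  have huv : u = ‖u‖ • v := by rw [hv, smul_smul, mul_inv_cancel₀ hn.ne', one_smul]
  have hS' : (0 : ℝ) < S := by exact_mod_cast hS
  have hX : ∀ R : Fin S → κ → ℝ, ‖shortcut R u‖ ^ 2 =
      ‖u‖ ^ 2 * ((∑ i, (∑ j, R i j * v j) ^ 2) / S) := by
    intro R
    rw [norm_shortcut_sq, ← mul_div_assoc, Finset.mul_sum]
    congr 1
    refine Finset.sum_congr rfl fun i _ => ?_
    rw [← mul_pow, Finset.mul_sum]
    congr 1
    refine Finset.sum_congr rfl fun j _ => ?_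
    conv_lhs => rw [huv]
    simp only [PiLp.smul_apply, smul_eq_mul]
    ring
  set A := {R : Fin S → κ → ℝ | (1 - ε) * ‖u‖ ^ 2 ≤ ‖shortcut R u‖ ^ 2 ∧
        ‖shortcut R u‖ ^ 2 ≤ (1 + ε) * ‖u‖ ^ 2}
  set B := {R : Fin S → κ → ℝ | (1 + ε) * S ≤ ∑ i, (∑ j, R i j * v j) ^ 2}
  set B' := {R : Fin S → κ → ℝ | ∑ i, (∑ j, R i j * v j) ^ 2 ≤ (1 - ε) * S}
  have hcover : (Set.univ : Set (Fin S → κ → ℝ)) ⊆ A ∪ (B ∪ B') := by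
    intro R _
    by_cases hB : R ∈ B
    · exact Or.inr (Or.inl hB)
    by_cases hB' : R ∈ B'
    · exact Or.inr (Or.inr hB')
    left
    simp only [B, B', Set.mem_ofPred_eq, not_le] at hB hB'
    simp only [A, Set.mem_ofPred_eq]
    rw [hX, mul_comm (1 - ε), mul_comm (1 + ε)]
    exact ⟨mul_le_mul_of_nonneg_left ((le_div_iff₀ hS').2 hB'.le) (by positivity),
      mul_le_mul_of_nonneg_left ((div_le_iff₀ hS').2 hB.le) (by positivity)⟩
  have h := measureReal_mono (μ := gaussianMatrix S κ) hcover
  have hu1 := measureReal_union_le (μ := gaussianMatrix S κ) A (B ∪ B')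
  have hu2 := measureReal_union_le (μ := gaussianMatrix S κ) B B'
  have hb := measureReal_sum_sq_ge_le (κ := κ) S hv1 h0
  have hb' := measureReal_sum_sq_le_le (κ := κ) S hv1 h0 h1
  rw [probReal_univ] at h
  linarith

end GaussianMatrix

/-- A projection dimension that makes the failure probability at most `2 / T ^ 2`. -/
noncomputable def projDim (ε : ℝ) (T : ℕ) : ℕ := ⌈2 * log T / chiSqRate ε⌉₊ + 1

lemma two_mul_exp_projDim_le {ε : ℝ} (h0 : 0 < ε) (h1 : ε < 1) {T : ℕ} (hT : 1 ≤ T) :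
    2 * exp (-(chiSqRate ε * projDim ε T)) ≤ 2 / (T : ℝ) ^ 2 := by
  have hT' : (0 : ℝ) < T := by exact_mod_cast hT
  have hc := chiSqRate_pos h0 h1
  have h : 2 * log T ≤ chiSqRate ε * projDim ε T := by
    rw [mul_comm (chiSqRate ε), ← div_le_iff₀ hc, projDim]
    push_cast
    linarith [Nat.le_ceil (2 * log T / chiSqRate ε)]
  have h2 : exp (-(chiSqRate ε * projDim ε T)) ≤ exp (-(2 * log T)) := exp_le_exp.2 (by linarith)
  have h3 : exp (-(2 * log T)) = 1 / (T : ℝ) ^ 2 := by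
    rw [exp_neg, mul_comm, exp_mul, exp_log hT', one_div]
    norm_cast
  calc _ ≤ 2 * (1 / (T : ℝ) ^ 2) := by rw [← h3]; linarith
    _ = _ := by ring

lemma projDim_isBigO_log {ε : ℝ} (h0 : 0 < ε) (h1 : ε < 1) :
    (fun T : ℕ => (projDim ε T : ℝ)) =O[Filter.atTop] (fun T : ℕ => log (T : ℝ)) := by
  have hc := chiSqRate_pos h0 h1
  refine Asymptotics.IsBigO.of_bound (2 / chiSqRate ε + 2) ?_
  have hlog : ∀ᶠ T : ℕ in Filter.atTop, 1 ≤ log (T : ℝ) :=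
    (tendsto_log_atTop.comp tendsto_natCast_atTop_atTop).eventually_ge_atTop 1
  filter_upwards [hlog] with T hT
  rw [Real.norm_of_nonneg (by positivity), Real.norm_of_nonneg (by linarith), projDim]
  push_cast
  have := (Nat.ceil_lt_add_one (a := 2 * log T / chiSqRate ε) (by positivity)).le
  calc _ ≤ 2 * log T / chiSqRate ε + 2 := by linarith
    _ ≤ 2 * log T / chiSqRate ε + 2 * log T := by linarith
    _ = _ := by ring

end TELM

namespace TELM

section Approximation

open Filter Topology

/-- Softmax at low temperature tends to the uniform distribution on the set of maximizers. -/
lemma tendsto_softmax {α : Type*} {J I : Finset α} (hIJ : I ⊆ J) (hI : I.Nonempty)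
    [DecidableEq α] {a : α → ℝ} {m : ℝ} (heq : ∀ s ∈ I, a s = m) (hlt : ∀ s ∈ J, s ∉ I → a s < m)
    {s : α} (hs : s ∈ J) :
    Tendsto (fun β : ℝ => Real.exp (β * a s) / ∑ r ∈ J, Real.exp (β * a r)) atTop
      (𝓝 (if s ∈ I then (I.card : ℝ)⁻¹ else 0)) := by
  have key : ∀ r ∈ J, Tendsto (fun β : ℝ => Real.exp (β * (a r - m))) atTop
      (𝓝 (if r ∈ I then 1 else 0)) := by
    intro r hr
    split_ifs with h
    · simp [heq r h]
    · exact Real.tendsto_exp_atBot.comp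
        (tendsto_id.atTop_mul_const_of_neg (sub_neg.2 (hlt r hr h)))
  have hsum : Tendsto (fun β : ℝ => ∑ r ∈ J, Real.exp (β * (a r - m))) atTop (𝓝 (I.card : ℝ)) := by
    have := tendsto_finsetSum J key
    rwa [Finset.sum_ite_mem, Finset.inter_eq_right.2 hIJ, Finset.sum_const, nsmul_one] at this
  have hcard : (I.card : ℝ) ≠ 0 := by exact_mod_cast hI.card_pos.ne'
  have h := (key s hs).div hsum hcard
  have hval : (if s ∈ I then (I.card : ℝ)⁻¹ else 0) = (if s ∈ I then 1 else 0) / (I.card : ℝ) := by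
    split_ifs <;> simp
  rw [hval]
  refine h.congr fun β => ?_
  simp only [Pi.div_apply, mul_sub, Real.exp_sub]
  rw [← Finset.sum_div, div_div_div_cancel_right₀ (Real.exp_pos _).ne']

variable {T D Dk Dv W : ℕ}

lemma Layer.continuous_mlp (L : Layer D Dk Dv W) :
    Continuous (fun H : Matrix (Fin T) (Fin Dv) ℝ => L.mlp H) := by
  refine continuous_matrix fun t i => ?_
  unfold Layer.mlp
  simp only [Matrix.of_apply, Matrix.mul_apply]
  fun_prop

lemma continuous_causalSoftmax :
    Continuous (causalSoftmax : Matrix (Fin T) (Fin T) ℝ → Matrix (Fin T) (Fin T) ℝ) := by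
  refine continuous_matrix fun t s => ?_
  unfold causalSoftmax
  simp only [Matrix.of_apply]
  split_ifs
  · refine Continuous.div (by fun_prop) (by fun_prop) fun A => ?_
    exact (Finset.sum_pos (fun _ _ => Real.exp_pos _) ⟨t, by simp⟩).ne'
  · exact continuous_const

lemma Layer.continuous_apply (L : Layer D Dk Dv W) :
    Continuous (fun H : Matrix (Fin T) (Fin D) ℝ => L.apply H) := by
  refine L.continuous_mlp.comp ?_
  unfold Layer.attn
  refine (continuous_causalSoftmax.comp ?_).matrix_mul (by fun_prop)
  fun_prop

lemma continuous_foldl_apply (Ls : List (Layer D Dk Dv W)) :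
    Continuous (fun H : Matrix (Fin T) (Fin D) ℝ => Ls.foldl (fun H L => L.apply H) H) := by
  induction Ls with
  | nil => exact continuous_id
  | cons L Ls ih => exact ih.comp L.continuous_apply

/-- Stacks of `l` layers map the family `X` arbitrarily close to the family `Y`. -/
def LayersApprox (Dk Dv W l : ℕ) {𝓘 : Type*} (X Y : 𝓘 → Matrix (Fin T) (Fin D) ℝ) : Prop :=
  ∀ U ∈ 𝓝 Y, ∃ Ls : List (Layer D Dk Dv W), Ls.length = l ∧
    (fun i => Ls.foldl (fun H L => L.apply H) (X i)) ∈ U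

lemma LayersApprox.refl {𝓘 : Type*} (X : 𝓘 → Matrix (Fin T) (Fin D) ℝ) :
    LayersApprox Dk Dv W 0 X X :=
  fun _ hU => ⟨[], rfl, mem_of_mem_nhds hU⟩

lemma LayersApprox.trans {𝓘 : Type*} {l l' : ℕ} {X Y Z : 𝓘 → Matrix (Fin T) (Fin D) ℝ}
    (h : LayersApprox Dk Dv W l X Y) (h' : LayersApprox Dk Dv W l' Y Z) :
    LayersApprox Dk Dv W (l + l') X Z := by
  intro U hU
  obtain ⟨Ls', hl', hU'⟩ := h' (interior U) (interior_mem_nhds.2 hU)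
  have hc : Continuous fun (H : 𝓘 → Matrix (Fin T) (Fin D) ℝ) i =>
      Ls'.foldl (fun H L => L.apply H) (H i) :=
    continuous_pi fun i => (continuous_foldl_apply Ls').comp (continuous_apply i)
  obtain ⟨Ls, hl, hLs⟩ := h _ ((isOpen_interior.preimage hc).mem_nhds hU')
  refine ⟨Ls ++ Ls', by simp [hl, hl'], ?_⟩
  simp only [List.foldl_append]
  exact interior_subset hLs

variable {ι ω : Type*} [Fintype ω]

/-- `φ` is computed by a ReLU network whose hidden units are indexed by `ω`. -/
def IsReLUNet (ω : Type*) [Fintype ω] (φ : (ι → ℝ) → ι → ℝ) : Prop :=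
  ∃ (a : ω → (ι → ℝ) →ₗ[ℝ] ℝ) (b : ω → ℝ) (w : ω → ι → ℝ),
    ∀ x i, φ x i = ∑ k, max (a k x + b k) 0 * w k i

lemma isReLUNet_comp (A : ω → (ι → ℝ) →ₗ[ℝ] ℝ) (b : ω → ℝ) (B : (ω → ℝ) →ₗ[ℝ] ι → ℝ) :
    IsReLUNet ω fun x => B fun k => max (A k x + b k) 0 := by
  classical
  refine ⟨A, b, fun k => B (Pi.single k 1), fun x i => ?_⟩
  change B (fun k => max (A k x + b k) 0) i = _
  rw [LinearMap.pi_apply_eq_sum_univ B, Finset.sum_apply]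
  refine Finset.sum_congr rfl fun k _ => ?_
  rw [Pi.smul_apply, smul_eq_mul]
  have : (fun j => if k = j then (1 : ℝ) else 0) = Pi.single k 1 := by
    ext j; simp [Pi.single_apply, eq_comm]
  rw [this]

/-- A family of `T × ι` matrices with its columns enumerated. -/
def enumCols {𝓘 : Type*} (e : ι ≃ Fin D) (X : 𝓘 → Fin T → ι → ℝ) :
    𝓘 → Matrix (Fin T) (Fin D) ℝ :=
  fun i => Matrix.of fun t d => X i t (e.symm d)

variable [Fintype ι]

lemma sum_mul_single [DecidableEq ι] (e : ι ≃ Fin D) (f : (ι → ℝ) →ₗ[ℝ] ℝ) (x : ι → ℝ) :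
    ∑ d, x (e.symm d) * f (Pi.single (e.symm d) 1) = f x := by
  rw [Equiv.sum_comp e.symm fun i => x i * f (Pi.single i 1), LinearMap.pi_apply_eq_sum_univ f x]
  refine Finset.sum_congr rfl fun i _ => ?_
  rw [smul_eq_mul]
  congr 2
  ext j
  simp [Pi.single_apply, eq_comm]

/-- A layer with score `∑ j, q j (X t) * k j (X s)` and MLP `φ` approximates the map which averages
over the maximizers of the score and then applies `φ`. -/
theorem layersApprox_of_isReLUNet {𝓘 : Type*} (e : ι ≃ Fin D) (hW : Fintype.card ω = W)
    (q k : Fin Dk → (ι → ℝ) →ₗ[ℝ] ℝ) (hDk : 0 < Dk) {φ : (ι → ℝ) → ι → ℝ}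
    (hφ : IsReLUNet ω φ) (X : 𝓘 → Fin T → ι → ℝ) (I : Fin T → Finset (Fin T))
    (hI : ∀ t, (I t).Nonempty) (hle : ∀ t, ∀ s ∈ I t, s ≤ t) (m : 𝓘 → Fin T → ℝ)
    (heq : ∀ i t, ∀ s ∈ I t, ∑ j, q j (X i t) * k j (X i s) = m i t)
    (hlt : ∀ i t s, s ≤ t → s ∉ I t → ∑ j, q j (X i t) * k j (X i s) < m i t) :
    LayersApprox Dk D W 1 (enumCols e X)
      (enumCols e fun i t => φ fun c => ((I t).card : ℝ)⁻¹ * ∑ s ∈ I t, X i s c) := by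
  classical
  obtain ⟨a, b, w, hφ'⟩ := id hφ
  let eω : ω ≃ Fin W := Fintype.equivFinOfCardEq hW
  let L : ℝ → Layer D Dk D W := fun β =>
    { wQ := Matrix.of fun d j => β * q j (Pi.single (e.symm d) 1)
      wK := Matrix.of fun d j => k j (Pi.single (e.symm d) 1)
      wV := 1
      w₁ := Matrix.of fun d n => a (eω.symm n) (Pi.single (e.symm d) 1)
      b₁ := fun n => b (eω.symm n)
      w₂ := Matrix.of fun n d => w (eω.symm n) (e.symm d)
      b₂ := 0 }
  have hmlp : ∀ β (Y : 𝓘 → Fin T → ι → ℝ) i, (L β).mlp (enumCols e Y i) =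
      enumCols e (fun i t => φ (Y i t)) i := by
    intro β Y i
    ext t d
    simp only [Layer.mlp, enumCols, L, Matrix.of_apply, Matrix.mul_apply, sum_mul_single e,
      hφ', Pi.zero_apply, add_zero]
    exact Equiv.sum_comp eω.symm fun n => max (a n (Y i t) + b n) 0 * w n (e.symm d)
  have hattn : ∀ i, Tendsto (fun β => (L β).attn (enumCols e X i)) atTop
      (𝓝 (enumCols e (fun i t c => ((I t).card : ℝ)⁻¹ * ∑ s ∈ I t, X i s c) i)) := by
    intro i
    refine tendsto_pi_nhds.2 fun t => tendsto_pi_nhds.2 fun d => ?_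
    have hsm : ∀ s, Tendsto (fun β => causalSoftmax ((Real.sqrt (Dk : ℝ))⁻¹ •
        ((enumCols e X i * (L β).wQ) * (enumCols e X i * (L β).wK).transpose)) t s) atTop
        (𝓝 (if s ∈ I t then ((I t).card : ℝ)⁻¹ else 0)) := by
      intro s
      by_cases hs : s ≤ t
      · have h := tendsto_softmax (J := Finset.Iic t) (I := I t)
          (fun s hs => Finset.mem_Iic.2 (hle t s hs)) (hI t) (heq i t)
          (fun s hs h => hlt i t s (Finset.mem_Iic.1 hs) h) (Finset.mem_Iic.2 hs)
        have hpos : 0 < (Real.sqrt (Dk : ℝ))⁻¹ := by positivity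
        have h' := h.comp (tendsto_id.const_mul_atTop hpos)
        refine h'.congr fun β => ?_
        have hscore : ∀ s, ((Real.sqrt (Dk : ℝ))⁻¹ •
            ((enumCols e X i * (L β).wQ) * (enumCols e X i * (L β).wK).transpose)) t s =
            (Real.sqrt (Dk : ℝ))⁻¹ * β * ∑ j, q j (X i t) * k j (X i s) := by
          intro s
          simp only [Matrix.smul_apply, Matrix.mul_apply, Matrix.transpose_apply, enumCols, L,
            Matrix.of_apply, smul_eq_mul, mul_left_comm _ β, ← Finset.mul_sum, sum_mul_single e,
            mul_assoc]
        simp only [causalSoftmax, Matrix.of_apply, if_pos hs, hscore, Function.comp_apply, id]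
      · rw [if_neg fun h => hs (hle t s h)]
        refine tendsto_const_nhds.congr fun β => ?_
        simp [causalSoftmax, hs]
    have hsum := tendsto_finsetSum Finset.univ fun s (_ : s ∈ Finset.univ) =>
      (hsm s).mul_const (X i s (e.symm d))
    have hval : ∑ s, (if s ∈ I t then ((I t).card : ℝ)⁻¹ else 0) * X i s (e.symm d) =
        ((I t).card : ℝ)⁻¹ * ∑ s ∈ I t, X i s (e.symm d) := by
      simp [Finset.mul_sum, ite_mul]
    rw [hval] at hsum
    refine hsum.congr fun β => ?_
    simp only [Layer.attn, L, Matrix.mul_one]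
    rfl
  intro U hU
  have hlim : Tendsto (fun β i => (L β).apply (enumCols e X i)) atTop
      (𝓝 (enumCols e fun i t => φ fun c => ((I t).card : ℝ)⁻¹ * ∑ s ∈ I t, X i s c)) := by
    rw [tendsto_pi_nhds]
    intro i
    have h0 := ((L 0).continuous_mlp.tendsto _).comp (hattn i)
    rw [hmlp] at h0
    exact h0
  obtain ⟨β, hβ⟩ := (hlim.eventually hU).exists
  exact ⟨[L β], rfl, hβ⟩

end Approximation

end TELM

namespace TELM

noncomputable section

/-- The coordinates of a hidden state: a value for every state in `Q`, and four positional
coordinates (position, code of the unread bits, offset, constant one). -/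
abbrev Coord (Q : Type*) := Q ⊕ Fin 4

/-- The hidden units of the MLPs. -/
abbrev HiddenUnit (Q : Type*) := Option (Coord Q ⊕ Coord Q ⊕ Q × Q × Bool × Bool)

section Networks

variable {Q : Type*}

/-- Update of the positional coordinates after reading the bit `b` of weight `c`. -/
def nextCoord (c b : ℝ) : (Coord Q → ℝ) →ₗ[ℝ] Coord Q → ℝ where
  toFun y := Sum.elim (fun q => y (.inl q))
    ![y (.inr 0), 3 * y (.inr 1) - 2 * b * y (.inr 3), y (.inr 2) + c * b * y (.inr 3), y (.inr 3)]
  map_add' y z := by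
    ext (q | j)
    · simp
    · fin_cases j <;> simp <;> ring
  map_smul' a y := by
    ext (q | j)
    · simp
    · fin_cases j <;> simp <;> ring

/-- The output weights of the network which sorts the coordinates by the next bit. -/
def splitOut (c : ℝ) : (HiddenUnit Q → ℝ) →ₗ[ℝ] Bool × Coord Q → ℝ :=
  let unit (k : HiddenUnit Q) : (HiddenUnit Q → ℝ) →ₗ[ℝ] ℝ := LinearMap.proj k
  LinearMap.pi fun i =>
    LinearMap.proj i.2 ∘ₗ bif i.1
      then nextCoord c 1 ∘ₗ LinearMap.pi fun j => unit (some (.inr (.inl j))) - unit none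
      else nextCoord c 0 ∘ₗ LinearMap.pi fun j =>
        unit (some (.inl j)) - (unit (some (.inr (.inl j))) - unit none)

lemma splitOut_true (c : ℝ) (h : HiddenUnit Q → ℝ) (i : Coord Q) : splitOut c h (true, i) =
    nextCoord c 1 (fun j => h (some (.inr (.inl j))) - h none) i := rfl

lemma splitOut_false (c : ℝ) (h : HiddenUnit Q → ℝ) (i : Coord Q) : splitOut c h (false, i) =
    nextCoord c 0 (fun j => h (some (.inl j)) - (h (some (.inr (.inl j))) - h none)) i := rfl

/-- The input weights of the network which sorts the coordinates by the next bit. -/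
def splitIn (K : ℝ) : HiddenUnit Q → (Bool × Coord Q → ℝ) →ₗ[ℝ] ℝ
  | none => (3 * K) • LinearMap.proj (true, .inr 1)
  | some (.inl i) => LinearMap.proj (true, i)
  | some (.inr (.inl i)) => LinearMap.proj (true, i) + (3 * K) • LinearMap.proj (true, .inr 1)
  | some (.inr (.inr _)) => 0

/-- The biases of the network which sorts the coordinates by the next bit. -/
def splitBias (K : ℝ) : HiddenUnit Q → ℝ
  | none => -(2 * K)
  | some (.inl _) => 0
  | some (.inr (.inl _)) => -(2 * K)
  | some (.inr (.inr _)) => 0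

/-- The network which sorts the coordinates by the next bit. -/
def splitNet (K c : ℝ) (x : Bool × Coord Q → ℝ) : Bool × Coord Q → ℝ :=
  splitOut c fun k => max (splitIn K k x + splitBias K k) 0

lemma isReLUNet_splitNet [Fintype Q] (K c : ℝ) : IsReLUNet (HiddenUnit Q) (splitNet (Q := Q) K c) :=
  isReLUNet_comp _ _ _

lemma splitNet_of_le {K c : ℝ} {x : Bool × Coord Q → ℝ} (h0 : ∀ i, 0 ≤ x (true, i))
    (hK : ∀ i, x (true, i) ≤ K) (hr : x (true, .inr 1) ≤ 1 / 3) (i : Coord Q) :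
    splitNet K c x (true, i) = 0 ∧
      splitNet K c x (false, i) = nextCoord c 0 (fun j => x (true, j)) i := by
  have hK0 : 0 ≤ K := (h0 (.inr 1)).trans (hK _)
  have hKr : K * x (true, .inr 1) ≤ K * (1 / 3) := mul_le_mul_of_nonneg_left hr hK0
  have h1 : max (splitIn K (none : HiddenUnit Q) x + splitBias K (none : HiddenUnit Q)) 0 = 0 := by
    apply max_eq_right
    simp only [splitIn, splitBias, LinearMap.smul_apply, LinearMap.proj_apply, smul_eq_mul]
    linarith
  have h2 : ∀ j, max (splitIn K (some (.inr (.inl j))) x + splitBias K (some (.inr (.inl j)))) 0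
      = 0 := by
    intro j
    apply max_eq_right
    simp only [splitIn, splitBias, LinearMap.add_apply, LinearMap.smul_apply, LinearMap.proj_apply,
      smul_eq_mul]
    linarith [hK j]
  have h3 : ∀ j, max (splitIn K (some (.inl j)) x + splitBias K (some (.inl j))) 0
      = x (true, j) := by
    intro j
    simpa [splitIn, splitBias] using h0 j
  constructor
  · simp only [splitNet, splitOut_true, h1, h2, sub_zero]
    exact congrFun (map_zero (nextCoord c 1)) i
  · simp only [splitNet, splitOut_false, h1, h2, h3,
      sub_zero]

lemma splitNet_of_ge {K c : ℝ} {x : Bool × Coord Q → ℝ} (h0 : ∀ i, 0 ≤ x (true, i))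
    (hK : ∀ i, x (true, i) ≤ K) (hr : 2 / 3 ≤ x (true, .inr 1)) (i : Coord Q) :
    splitNet K c x (true, i) = nextCoord c 1 (fun j => x (true, j)) i ∧
      splitNet K c x (false, i) = 0 := by
  have hK0 : 0 ≤ K := (h0 (.inr 1)).trans (hK _)
  have hKr : K * (2 / 3) ≤ K * x (true, .inr 1) := mul_le_mul_of_nonneg_left hr hK0
  have h1 : max (splitIn K (none : HiddenUnit Q) x + splitBias K (none : HiddenUnit Q)) 0 = 3 * K * x (true, .inr 1) - 2 * K := by
    simp only [splitIn, splitBias, LinearMap.smul_apply, LinearMap.proj_apply, smul_eq_mul]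
    rw [max_eq_left (by linarith)]
    ring
  have h2 : ∀ j, max (splitIn K (some (.inr (.inl j))) x + splitBias K (some (.inr (.inl j)))) 0
      = x (true, j) + (3 * K * x (true, .inr 1) - 2 * K) := by
    intro j
    simp only [splitIn, splitBias, LinearMap.add_apply, LinearMap.smul_apply, LinearMap.proj_apply,
      smul_eq_mul]
    rw [max_eq_left (by linarith [h0 j])]
    ring
  have h3 : ∀ j, max (splitIn K (some (.inl j)) x + splitBias K (some (.inl j))) 0
      = x (true, j) := by
    intro j
    simpa [splitIn, splitBias] using h0 j
  constructor
  · simp only [splitNet, splitOut_true, h1, h2,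
      add_sub_cancel_right]
  · simp only [splitNet, splitOut_false, h1, h2, h3,
      add_sub_cancel_right, sub_self]
    exact congrFun (map_zero (nextCoord c 0)) i

variable [Fintype Q]

/-- The output weights of the network which composes two functions. -/
def mergeOut : (HiddenUnit Q → ℝ) →ₗ[ℝ] Bool × Coord Q → ℝ where
  toFun h i := bif i.1
    then h (some (.inr (.inl i.2))) + 2 * Sum.elim
      (fun q => ∑ p, (h (some (.inr (.inr (q, p, true, false))))
        - h (some (.inr (.inr (q, p, false, false))))
        - (h (some (.inr (.inr (q, p, true, true)))) - h (some (.inr (.inr (q, p, false, true)))))))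
      (fun j => h (some (.inl (.inr j)))) i.2
    else 0
  map_add' g h := by
    ext ⟨_ | _, q | j⟩
    · simp
    · simp
    · simp only [cond_true, Pi.add_apply, Sum.elim_inl, Finset.sum_sub_distrib,
        Finset.sum_add_distrib]
      ring
    · simp only [cond_true, Pi.add_apply, Sum.elim_inr]
      ring
  map_smul' a h := by
    ext ⟨_ | _, q | j⟩
    · simp
    · simp
    · simp only [cond_true, Pi.smul_apply, Sum.elim_inl, Finset.sum_sub_distrib,
        smul_eq_mul, RingHom.id_apply, ← Finset.mul_sum]
      ring
    · simp only [cond_true, Pi.smul_apply, Sum.elim_inr, smul_eq_mul, RingHom.id_apply]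
      ring

/-- The input weights of the network which composes two functions. -/
def mergeIn (K : ℝ) : HiddenUnit Q → (Bool × Coord Q → ℝ) →ₗ[ℝ] ℝ
  | none => 0
  | some (.inl i) => LinearMap.proj (true, i)
  | some (.inr (.inl i)) => LinearMap.proj (false, i) - K • LinearMap.proj (true, .inr 3)
  | some (.inr (.inr (q, p, u, _))) =>
      (bif u then LinearMap.proj (true, .inl p) else 0) + K • LinearMap.proj (false, .inl q)

/-- The biases of the network which composes two functions. -/
def mergeBias (e : Q → ℕ) (K : ℝ) : HiddenUnit Q → ℝ
  | none => 0
  | some (.inl _) => 0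
  | some (.inr (.inl _)) => 0
  | some (.inr (.inr (_, p, _, v))) => -(K * ((e p + bif v then 1 else 0) / 2))

/-- The network which composes two functions. -/
def mergeNet (e : Q → ℕ) (K : ℝ) (x : Bool × Coord Q → ℝ) : Bool × Coord Q → ℝ :=
  mergeOut fun k => max (mergeIn K k x + mergeBias e K k) 0

lemma isReLUNet_mergeNet (e : Q → ℕ) (K : ℝ) : IsReLUNet (HiddenUnit Q) (mergeNet e K) :=
  isReLUNet_comp _ _ _

lemma mergeNet_false (e : Q → ℕ) (K : ℝ) (x : Bool × Coord Q → ℝ) (i : Coord Q) :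
    mergeNet e K x (false, i) = 0 := rfl

lemma mergeNet_of_zero {e : Q → ℕ} {K : ℝ} {x : Bool × Coord Q → ℝ} (ht : ∀ i, x (true, i) = 0)
    (hf : ∀ i, 0 ≤ x (false, i)) (i : Coord Q) : mergeNet e K x (true, i) = x (false, i) := by
  rcases i with q | j
  · simp [mergeNet, mergeOut, mergeIn, mergeBias, ht, hf]
  · simp [mergeNet, mergeOut, mergeIn, mergeBias, ht, hf]

lemma relu_step_sub {K g : ℝ} (hg : 0 ≤ g) (hgK : g ≤ K) (a b : ℕ) :
    max (g / 2 + K * (a / 2) + -(K * (b / 2))) 0 - max (K * ((a : ℝ) / 2) + -(K * (b / 2))) 0 =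
      if b ≤ a then g / 2 else 0 := by
  have hK : 0 ≤ K := hg.trans hgK
  split_ifs with h
  · have h' : (b : ℝ) ≤ a := by exact_mod_cast h
    have := mul_le_mul_of_nonneg_left h' hK
    rw [max_eq_left (by linarith), max_eq_left (by linarith)]
    ring
  · have h' : (a : ℝ) + 1 ≤ b := by exact_mod_cast not_le.1 h
    have := mul_le_mul_of_nonneg_left h' hK
    rw [max_eq_right (by linarith), max_eq_right (by linarith), sub_zero]

lemma mergeNet_of_half {e : Q → ℕ} (he : Function.Injective e) {K : ℝ} {x : Bool × Coord Q → ℝ}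
    {y z : Coord Q → ℝ} (hy0 : ∀ i, 0 ≤ y i) (hyK : ∀ i, y i ≤ K) (hzK : ∀ i, z i ≤ K)
    (hy1 : y (.inr 3) = 1) (f : Q → Q) (hf : ∀ q, z (.inl q) = e (f q))
    (ht : ∀ i, x (true, i) = y i / 2) (hx : ∀ i, x (false, i) = z i / 2) :
    (∀ q, mergeNet e K x (true, .inl q) = y (.inl (f q))) ∧
      ∀ j, mergeNet e K x (true, .inr j) = y (.inr j) := by
  have hgate : ∀ i, max (mergeIn K (some (.inr (.inl i))) x
      + mergeBias e K (some (.inr (.inl i)))) 0 = 0 := by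
    intro i
    apply max_eq_right
    simp only [mergeIn, mergeBias, LinearMap.sub_apply, LinearMap.smul_apply, LinearMap.proj_apply,
      smul_eq_mul, ht, hx, hy1]
    linarith [hzK i]
  constructor
  · intro q
    simp only [mergeNet, mergeOut, LinearMap.coe_mk, AddHom.coe_mk, cond_true, hgate,
      Sum.elim_inl, zero_add]
    have hterm : ∀ p (v : Bool),
        max (mergeIn K (some (.inr (.inr (q, p, true, v)))) x
          + mergeBias e K (some (.inr (.inr (q, p, true, v))))) 0
        - max (mergeIn K (some (.inr (.inr (q, p, false, v)))) x
          + mergeBias e K (some (.inr (.inr (q, p, false, v))))) 0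
        = if (e p + bif v then 1 else 0) ≤ e (f q) then y (.inl p) / 2 else 0 := by
      intro p v
      rw [← relu_step_sub (hy0 _) (hyK _)]
      cases v <;> simp [mergeIn, mergeBias, ht, hx, hf]
    simp only [hterm]
    rw [Finset.sum_eq_single (f q)]
    · simp; ring
    · intro p _ hp
      have hne : e p ≠ e (f q) := fun h => hp (he h)
      by_cases h : e p ≤ e (f q)
      · have h' : e p + 1 ≤ e (f q) := by omega
        simp [h, h']
      · have h' : ¬ e p + 1 ≤ e (f q) := by omega
        simp [h, h']
    · simp
  · intro j
    simp only [mergeNet, mergeOut, LinearMap.coe_mk, AddHom.coe_mk, cond_true, hgate,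
      Sum.elim_inr, zero_add]
    simp only [mergeIn, mergeBias, LinearMap.proj_apply, ht, add_zero]
    rw [max_eq_left (by linarith [hy0 (.inr j)])]
    ring

end Networks

end

end TELM

namespace TELM

noncomputable section

/-- The number in `[0, 1]` whose ternary digits are the doubled `l` lowest binary digits of `n`. -/
def cantorCode : ℕ → ℕ → ℝ
  | 0, _ => 0
  | l + 1, n => (2 * ((n % 2 : ℕ) : ℝ) + cantorCode l (n / 2)) / 3

lemma cantorCode_nonneg (l n : ℕ) : 0 ≤ cantorCode l n := by
  induction l generalizing n with
  | zero => exact le_rfl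
  | succ l ih => have := ih (n / 2); unfold cantorCode; positivity

lemma cantorCode_le_one (l n : ℕ) : cantorCode l n ≤ 1 := by
  induction l generalizing n with
  | zero => exact zero_le_one
  | succ l ih =>
    have h := ih (n / 2)
    have h2 : ((n % 2 : ℕ) : ℝ) ≤ 1 := by exact_mod_cast Nat.lt_succ_iff.1 (Nat.mod_lt n two_pos)
    unfold cantorCode
    linarith

section Blocks

variable {T : ℕ}

/-- The last position before the block of length `2 ^ k` which contains `t`. -/
def prevEnd (k : ℕ) (t : Fin T) : Fin T :=
  ⟨t - (t % 2 ^ k + 1), (Nat.sub_le _ _).trans_lt t.2⟩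

/-- The bit of weight `2 ^ k` of `t`. -/
def bit (k t : ℕ) : ℕ := t / 2 ^ k % 2

lemma bit_eq_zero_or_one (k t : ℕ) : bit k t = 0 ∨ bit k t = 1 := Nat.mod_two_eq_zero_or_one _

lemma mod_two_pow_succ (k t : ℕ) : t % 2 ^ (k + 1) = t % 2 ^ k + 2 ^ k * bit k t :=
  Nat.mod_pow_succ

lemma div_two_pow_succ (k t : ℕ) : t / 2 ^ (k + 1) = t / 2 ^ k / 2 := by
  rw [pow_succ, Nat.div_div_eq_div_mul]

lemma div_two_pow_of_bit {k t : ℕ} (h : bit k t = 1) :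
    t / 2 ^ k = 2 * (t / 2 ^ (k + 1)) + 1 := by
  rw [div_two_pow_succ]; unfold bit at h; omega

lemma div_two_pow_of_not_bit {k t : ℕ} (h : bit k t = 0) :
    t / 2 ^ k = 2 * (t / 2 ^ (k + 1)) := by
  rw [div_two_pow_succ]; unfold bit at h; omega

lemma prevEnd_add {k : ℕ} {t : Fin T} (h : bit k t = 1) :
    (prevEnd k t : ℕ) + (t % 2 ^ k + 1) = t := by
  have h1 : 1 ≤ (t : ℕ) / 2 ^ k := by rw [div_two_pow_of_bit h]; omega
  have h2 := Nat.div_add_mod (t : ℕ) (2 ^ k)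
  have h3 : 2 ^ k * 1 ≤ 2 ^ k * ((t : ℕ) / 2 ^ k) := Nat.mul_le_mul_left _ h1
  have h4 : 0 < 2 ^ k := by positivity
  change (t : ℕ) - (t % 2 ^ k + 1) + (t % 2 ^ k + 1) = t
  omega

lemma prevEnd_succ {k : ℕ} {t : Fin T} (h : bit k t = 1) :
    (prevEnd k t : ℕ) + 1 = t / 2 ^ k * 2 ^ k := by
  have h1 := prevEnd_add h
  have h2 := Nat.div_add_mod' (t : ℕ) (2 ^ k)
  omega

lemma prevEnd_div {k : ℕ} {t : Fin T} (h : bit k t = 1) :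
    (prevEnd k t : ℕ) / 2 ^ k = 2 * (t / 2 ^ (k + 1)) := by
  have h1 := prevEnd_succ h
  rw [div_two_pow_of_bit h] at h1
  have h4 : 0 < 2 ^ k := by positivity
  have h5 : (2 * ((t : ℕ) / 2 ^ (k + 1)) + 1) * 2 ^ k =
    2 * ((t : ℕ) / 2 ^ (k + 1)) * 2 ^ k + 2 ^ k := by ring
  exact Nat.div_eq_of_lt_le (by omega) (by omega)

lemma bit_prevEnd {k : ℕ} {t : Fin T} (h : bit k t = 1) : bit k (prevEnd k t) = 0 := by
  unfold bit
  rw [prevEnd_div h]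
  omega

lemma prevEnd_ne {k : ℕ} {t : Fin T} (h : bit k t = 1) : t ≠ prevEnd k t := by
  intro h'
  have := prevEnd_add h
  rw [← h'] at this
  omega

lemma le_prevEnd {k : ℕ} {s t : Fin T} (hst : s ≤ t) (ht : bit k t = 1) (hs : bit k s = 0) :
    (s : ℕ) + (t % 2 ^ k + 1) ≤ t := by
  by_contra hlt
  have h1 := prevEnd_add ht
  have h2 := prevEnd_succ ht
  have h3 : (t : ℕ) / 2 ^ k ≤ s / 2 ^ k := by
    rw [Nat.le_div_iff_mul_le (by positivity)]; omega
  have h4 : (s : ℕ) / 2 ^ k ≤ t / 2 ^ k := Nat.div_le_div_right hst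
  unfold bit at ht hs
  rw [le_antisymm h4 h3] at hs
  omega

variable {Γ Q : Type*}

/-- The transition function of the input word from the start of the block of length `2 ^ k`
which contains `t` up to `t`. -/
def blockMap (δ : Q → Γ → Q) (σ : Fin T → Γ) : ℕ → Fin T → Q → Q
  | 0, t, q => δ q (σ t)
  | k + 1, t, q =>
      if bit k t = 1 then blockMap δ σ k t (blockMap δ σ k (prevEnd k t) q)
      else blockMap δ σ k t q

lemma stateAfter_succ_eq_blockMap (δ : Q → Γ → Q) (q₀ : Q) (σ : Fin T → Γ) (k : ℕ) (t : Fin T) :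
    stateAfter δ q₀ σ (t + 1) = blockMap δ σ k t (stateAfter δ q₀ σ (t / 2 ^ k * 2 ^ k)) := by
  induction k generalizing t with
  | zero => simp [stateAfter, blockMap]
  | succ k ih =>
    rw [blockMap]
    have hp : (2 : ℕ) ^ (k + 1) = 2 * 2 ^ k := by ring
    split_ifs with h
    · rw [ih t, ← prevEnd_succ h, ih (prevEnd k t), prevEnd_div h, hp, mul_left_comm, mul_assoc]
    · have h0 := (bit_eq_zero_or_one k t).resolve_right h
      rw [ih t, div_two_pow_of_not_bit h0, hp, mul_left_comm, mul_assoc]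

lemma stateSeq_eq_blockMap (δ : Q → Γ → Q) (q₀ : Q) (σ : Fin T → Γ) {k : ℕ} (hk : T ≤ 2 ^ k)
    (t : Fin T) : stateSeq δ q₀ σ t = blockMap δ σ k t q₀ := by
  rw [stateSeq, stateAfter_succ_eq_blockMap δ q₀ σ k t, Nat.div_eq_of_lt (t.2.trans_le hk),
    zero_mul, stateAfter]

end Blocks

section Levels

variable {T : ℕ} {Γ Q : Type*} (δ : Q → Γ → Q) (e : Q → ℕ)

/-- Hidden coordinates which hold the block maps of length `2 ^ k`, and positional coordinates
for `j` processed bits of `j + l`. -/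
def coords (k j l : ℕ) (σ : Fin T → Γ) (t : Fin T) : Coord Q → ℝ :=
  Sum.elim (fun q => (e (blockMap δ σ k t q) : ℝ))
    ![(t : ℕ), cantorCode l (t / 2 ^ j), ((t % 2 ^ j : ℕ) : ℝ) + 1, 1]

lemma coords_nonneg (k j l : ℕ) (σ : Fin T → Γ) (t : Fin T) (i : Coord Q) :
    0 ≤ coords δ e k j l σ t i := by
  rcases i with q | i
  · simp [coords]
  · have := cantorCode_nonneg l (t / 2 ^ j)
    fin_cases i <;> simp [coords, this]
    positivity

lemma coords_le {N : ℕ} (he : ∀ q, e q ≤ N) (k j l : ℕ) (σ : Fin T → Γ) (t : Fin T)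
    (i : Coord Q) : coords δ e k j l σ t i ≤ N + T + 1 := by
  have hN : (0 : ℝ) ≤ N := Nat.cast_nonneg _
  have hT : (0 : ℝ) ≤ T := Nat.cast_nonneg _
  have ht : ((t : ℕ) : ℝ) ≤ T := by exact_mod_cast t.2.le
  have hm : ((t % 2 ^ j : ℕ) : ℝ) ≤ T := by exact_mod_cast (Nat.mod_le _ _).trans t.2.le
  rcases i with q | i
  · have : (e (blockMap δ σ k t q) : ℝ) ≤ N := by exact_mod_cast he _
    simp only [coords, Sum.elim_inl]
    linarith
  · have := cantorCode_le_one l (t / 2 ^ j)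
    fin_cases i <;> simp [coords] <;> linarith

lemma nextCoord_coords (k j l : ℕ) (σ : Fin T → Γ) (t : Fin T) (b : ℕ) (hb : bit j t = b) :
    nextCoord (2 ^ j) b (coords δ e k j (l + 1) σ t) = coords δ e k (j + 1) l σ t := by
  ext (q | i)
  · rfl
  · have h : (((t : ℕ) % 2 ^ (j + 1) : ℕ) : ℝ) = ((t % 2 ^ j : ℕ) : ℝ) + 2 ^ j * b := by
      rw [mod_two_pow_succ, hb]; push_cast; ring
    fin_cases i
    · rfl
    · simp [nextCoord, coords, cantorCode, div_two_pow_succ, ← hb, bit]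
      ring
    · simp only [nextCoord, coords, LinearMap.coe_mk, AddHom.coe_mk, Sum.elim_inr, Fin.reduceFinMk,
        Matrix.cons_val, h]
      ring
    · rfl

/-- Coordinates in the first half, zeros in the second half. -/
def levelState (k l : ℕ) (σ : Fin T → Γ) (t : Fin T) (i : Bool × Coord Q) : ℝ :=
  if i.1 then coords δ e k k l σ t i.2 else 0

/-- Coordinates in the first half if the bit `k` of the position is set, and otherwise in the
second half. -/
def splitState (k l : ℕ) (σ : Fin T → Γ) (t : Fin T) (i : Bool × Coord Q) : ℝ :=
  if i.1 = decide (bit k t = 1) then coords δ e k (k + 1) l σ t i.2 else 0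

/-- A positional coordinate as a linear functional. -/
def posCoord (c : Bool) (j : Fin 4) : (Bool × Coord Q → ℝ) →ₗ[ℝ] ℝ := LinearMap.proj (c, .inr j)

@[simp]
lemma posCoord_apply (c : Bool) (j : Fin 4) (x : Bool × Coord Q → ℝ) :
    posCoord c j x = x (c, .inr j) := rfl

/-- The query map which selects the position itself and, if the bit `k` of the position is set,
the last position before its block. -/
def mergeQuery (k : ℕ) : Fin 2 → (Bool × Coord Q → ℝ) →ₗ[ℝ] ℝ :=
  ![posCoord true 3 + posCoord false 3, (2 ^ k : ℝ) • posCoord true 3 - posCoord true 2]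

/-- The key map matching `mergeQuery`. -/
def mergeKey : Fin 2 → (Bool × Coord Q → ℝ) →ₗ[ℝ] ℝ :=
  ![posCoord true 0 + posCoord false 0, posCoord true 3]

variable [Fintype Q] {N D W : ℕ}

lemma layersApprox_split (he : ∀ q, e q ≤ N) (en : Bool × Coord Q ≃ Fin D)
    (hW : Fintype.card (HiddenUnit Q) = W) (k l : ℕ) :
    LayersApprox 2 D W 1 (enumCols en (levelState (T := T) δ e k (l + 1)))
      (enumCols en (splitState δ e k l)) := by
  have h := layersApprox_of_isReLUNet (T := T) (Dk := 2) en hW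
    ![posCoord true 3, 0] ![posCoord true 0, 0] two_pos
    (isReLUNet_splitNet (Q := Q) (N + T + 1) (2 ^ k)) (levelState δ e k (l + 1))
    (fun t => {t}) (fun t => Finset.singleton_nonempty t) (by simp) (fun _ t => (t : ℕ))
    (by simp [levelState, coords])
    (by
      intro σ t s hs hne
      have hlt : s < t := lt_of_le_of_ne hs (by simpa using hne)
      simpa [levelState, coords] using hlt)
  convert h using 2
  ext σ t ⟨c, i⟩
  simp only [Finset.card_singleton, Nat.cast_one, inv_one, Finset.sum_singleton, one_mul]
  have h0 : ∀ i, 0 ≤ levelState δ e k (l + 1) σ t (true, i) := fun i =>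
    coords_nonneg δ e k k (l + 1) σ t i
  have hK : ∀ i, levelState δ e k (l + 1) σ t (true, i) ≤ N + T + 1 := fun i =>
    coords_le δ e he k k (l + 1) σ t i
  have hcode : levelState δ e k (l + 1) σ t (true, .inr 1) =
      (2 * (bit k t : ℝ) + cantorCode l (t / 2 ^ k / 2)) / 3 := rfl
  have hc0 := cantorCode_nonneg l (t / 2 ^ k / 2)
  have hc1 := cantorCode_le_one l (t / 2 ^ k / 2)
  rcases bit_eq_zero_or_one k t with hb | hb
  · have hr : levelState δ e k (l + 1) σ t (true, .inr 1) ≤ 1 / 3 := by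
      rw [hcode, hb]; push_cast; linarith
    obtain ⟨h1, h2⟩ := splitNet_of_le (c := 2 ^ k) h0 hK hr i
    have hn := nextCoord_coords δ e k k l σ t 0 hb
    rw [Nat.cast_zero] at hn
    cases c
    · exact Eq.trans (by simp [splitState, hb]) ((congrFun hn i).symm.trans h2.symm)
    · exact Eq.trans (by simp [splitState, hb]) h1.symm
  · have hr : 2 / 3 ≤ levelState δ e k (l + 1) σ t (true, .inr 1) := by
      rw [hcode, hb]; push_cast; linarith
    obtain ⟨h1, h2⟩ := splitNet_of_ge (c := 2 ^ k) h0 hK hr i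
    have hn := nextCoord_coords δ e k k l σ t 1 hb
    rw [Nat.cast_one] at hn
    cases c
    · exact Eq.trans (by simp [splitState, hb]) h2.symm
    · exact Eq.trans (by simp [splitState, hb]) ((congrFun hn i).symm.trans h1.symm)

lemma layersApprox_merge (hinj : Function.Injective e) (he : ∀ q, e q ≤ N)
    (en : Bool × Coord Q ≃ Fin D) (hW : Fintype.card (HiddenUnit Q) = W) (k l : ℕ) :
    LayersApprox 2 D W 1 (enumCols en (splitState (T := T) δ e k l))
      (enumCols en (levelState δ e (k + 1) l)) := by
  have hscore : ∀ (σ : Fin T → Γ) (t s : Fin T),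
      ∑ j, mergeQuery k j (splitState δ e k l σ t) * mergeKey j (splitState δ e k l σ s) =
      (s : ℕ) - (bit k t * bit k s * (t % 2 ^ k + 1) : ℕ) := by
    intro σ t s
    have hm := mod_two_pow_succ k t
    rcases bit_eq_zero_or_one k t with ht | ht <;> rcases bit_eq_zero_or_one k s with hs | hs <;>
      rw [ht] at hm <;>
      simp [mergeQuery, mergeKey, splitState, coords, ht, hs, hm]
    ring
  have h := layersApprox_of_isReLUNet (T := T) (Dk := 2) en hW (mergeQuery k) mergeKey two_pos
    (isReLUNet_mergeNet (Q := Q) e (N + T + 1)) (splitState δ e k l)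
    (fun t => if bit k t = 1 then {t, prevEnd k t} else {t})
    (fun t => by split_ifs <;> simp)
    (by
      intro t s hs
      split_ifs at hs with h
      · rcases Finset.mem_insert.1 hs with rfl | hs
        · exact le_rfl
        · rw [Finset.mem_singleton.1 hs]
          exact Nat.sub_le _ _
      · exact (Finset.mem_singleton.1 hs).le)
    (fun _ t => (t : ℕ) - (bit k t * (t % 2 ^ k + 1) : ℕ))
    (by
      intro σ t s hs
      rw [hscore]
      split_ifs at hs with h
      · rcases Finset.mem_insert.1 hs with rfl | hs
        · rw [h, one_mul]
        · rw [Finset.mem_singleton.1 hs, bit_prevEnd h, h]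
          have := prevEnd_add h
          rw [eq_sub_iff_add_eq]
          push_cast
          rw [zero_mul, sub_zero, one_mul]
          exact_mod_cast this
      · rw [Finset.mem_singleton.1 hs, (bit_eq_zero_or_one k t).resolve_right h])
    (by
      intro σ t s hle hs
      rw [hscore, sub_lt_sub_iff, ← Nat.cast_add, ← Nat.cast_add, Nat.cast_lt]
      split_ifs at hs with h
      · simp only [Finset.mem_insert, Finset.mem_singleton, not_or] at hs
        have hlt : (s : ℕ) < t := lt_of_le_of_ne hle fun h' => hs.1 (Fin.ext h')
        rw [h]
        rcases bit_eq_zero_or_one k s with hb | hb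
        · rw [hb]
          have h1 := le_prevEnd hle h hb
          have h2 := prevEnd_add h
          have h3 : (s : ℕ) ≠ prevEnd k t := fun h' => hs.2 (Fin.ext h')
          simp only [mul_zero, zero_mul, one_mul]
          omega
        · rw [hb]
          simp only [one_mul]
          omega
      · have hlt : (s : ℕ) < t := lt_of_le_of_ne hle fun h' => hs (by simp [Fin.ext h'])
        rw [(bit_eq_zero_or_one k t).resolve_right h]
        simpa using hlt)
  convert h using 2
  ext σ t ⟨c, i⟩
  cases c
  · rw [mergeNet_false]; rfl
  · change coords δ e (k + 1) (k + 1) l σ t i = _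
    rcases bit_eq_zero_or_one k t with hb | hb
    · rw [mergeNet_of_zero]
      · simp only [hb, zero_ne_one, if_false, Finset.card_singleton, Nat.cast_one, inv_one,
          Finset.sum_singleton, one_mul]
        rcases i with q | i
        · simp [splitState, coords, hb, blockMap]
        · simp [splitState, coords, hb]
      · intro i
        simp [splitState, hb]
      · intro i
        simp only [hb, zero_ne_one, if_false, Finset.card_singleton, Nat.cast_one, inv_one,
          Finset.sum_singleton, one_mul, splitState]
        split_ifs
        · exact coords_nonneg _ _ _ _ _ _ _ _
        · exact le_rfl
    · have hb' := bit_prevEnd hb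
      obtain ⟨h1, h2⟩ := mergeNet_of_half hinj (K := N + T + 1)
        (x := fun c => (((if bit k t = 1 then {t, prevEnd k t} else {t} : Finset (Fin T)).card : ℝ)⁻¹
          * ∑ s ∈ (if bit k t = 1 then {t, prevEnd k t} else {t} : Finset (Fin T)),
            splitState δ e k l σ s c))
        (coords_nonneg δ e k (k + 1) l σ t) (coords_le δ e he k (k + 1) l σ t)
        (coords_le δ e he k (k + 1) l σ (prevEnd k t)) rfl (blockMap δ σ k (prevEnd k t))
        (fun q => rfl)
        (by
          intro i
          rw [if_pos hb, Finset.sum_pair (prevEnd_ne hb), Finset.card_pair (prevEnd_ne hb)]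
          simp [splitState, hb, hb']
          ring)
        (by
          intro i
          rw [if_pos hb, Finset.sum_pair (prevEnd_ne hb), Finset.card_pair (prevEnd_ne hb)]
          simp [splitState, hb, hb']
          ring)
      rcases i with q | i
      · rw [h1 q]
        simp [coords, blockMap, hb]
      · rw [h2 i]
        simp [coords]

lemma layersApprox_levels (hinj : Function.Injective e) (he : ∀ q, e q ≤ N)
    (en : Bool × Coord Q ≃ Fin D) (hW : Fintype.card (HiddenUnit Q) = W) (k l : ℕ) :
    LayersApprox 2 D W (2 * k) (enumCols en (levelState (T := T) δ e 0 (l + k)))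
      (enumCols en (levelState δ e k l)) := by
  induction k generalizing l with
  | zero => exact LayersApprox.refl _
  | succ k ih =>
    have h := ((ih (l + 1)).trans (layersApprox_split δ e he en hW k l)).trans
      (layersApprox_merge δ e hinj he en hW k l)
    rwa [show l + 1 + k = l + (k + 1) by ring] at h

end Levels

end

end TELM

namespace TELM

noncomputable section

open Filter Topology

section Simulation

variable {T : ℕ} {Γ Q : Type*}

/-- Logits which are maximal at the state whose code is the coordinate of `q₀`. -/
def readout {D : ℕ} (e : Q → ℕ) (en : Bool × Coord Q ≃ Fin D) (q₀ : Q) : Classifier D Q where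
  w := Matrix.of fun d q => if d = en (true, .inl q₀) then 2 * (e q : ℝ) else 0
  b q := -(e q : ℝ) ^ 2

lemma mul_readout {D : ℕ} (e : Q → ℕ) (en : Bool × Coord Q ≃ Fin D) (q₀ q : Q)
    (H : Matrix (Fin T) (Fin D) ℝ) (t : Fin T) : (H * (readout e en q₀).w) t q =
      H t (en (true, .inl q₀)) * (2 * (e q : ℝ)) := by
  simp [Matrix.mul_apply, readout]

variable [Fintype Q]

/-- Every automaton is simulated by a Transformer of logarithmic depth. -/
theorem exists_backbone_simulating [Finite Γ] [Nonempty Q] (δ : Q → Γ → Q) :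
    ∃ (M : Backbone Γ T) (c : Q → Classifier M.D Q),
      M.D = 2 * (Fintype.card Q + 4) ∧ M.W = 4 * Fintype.card Q ^ 2 + 2 * Fintype.card Q + 9 ∧
      M.Dk = 2 ∧ M.Dv = 2 * (Fintype.card Q + 4) ∧ M.depth = 2 * Nat.clog 2 T ∧
      ∀ (q₀ : Q) (σ : Fin T → Γ) (t : Fin T) (q : Q), q ≠ stateSeq δ q₀ σ t →
        M.logits (c q₀) σ t q < M.logits (c q₀) σ t (stateSeq δ q₀ σ t) := by
  let e : Q → ℕ := fun q => Fintype.equivFin Q q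
  have hinj : Function.Injective e := fun p q h => (Fintype.equivFin Q).injective (Fin.ext h)
  have he : ∀ q, e q ≤ Fintype.card Q := fun q => (Fintype.equivFin Q q).2.le
  have hD : Fintype.card (Bool × Coord Q) = 2 * (Fintype.card Q + 4) := by simp
  let en : Bool × Coord Q ≃ Fin (2 * (Fintype.card Q + 4)) := Fintype.equivFinOfCardEq hD
  have hW : Fintype.card (HiddenUnit Q) = 4 * Fintype.card Q ^ 2 + 2 * Fintype.card Q + 9 := by
    simp; ring
  set L := Nat.clog 2 T with hL
  have hT : T ≤ 2 ^ L := Nat.le_pow_clog one_lt_two T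
  have happrox := layersApprox_levels (T := T) δ e hinj he en hW L 0
  rw [zero_add] at happrox
  have hU : ∀ᶠ Y : (Fin T → Γ) → Matrix (Fin T) (Fin (2 * (Fintype.card Q + 4))) ℝ in
      𝓝 (enumCols en (levelState (T := T) δ e L 0)),
      ∀ (q₀ : Q) (σ : Fin T → Γ) (t : Fin T) (q : Q), q ≠ stateSeq δ q₀ σ t →
        Y σ t (en (true, .inl q₀)) * (2 * (e q : ℝ)) + -(e q : ℝ) ^ 2 <
          Y σ t (en (true, .inl q₀)) * (2 * (e (stateSeq δ q₀ σ t) : ℝ)) +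
            -(e (stateSeq δ q₀ σ t) : ℝ) ^ 2 := by
    simp only [eventually_all]
    intro q₀ σ t q hq
    have hcont : Continuous fun Y : (Fin T → Γ) → Matrix (Fin T) (Fin (2 * (Fintype.card Q + 4))) ℝ =>
        Y σ t (en (true, .inl q₀)) := (continuous_apply σ).matrix_elem t _
    refine ContinuousAt.eventually_lt ((hcont.mul_const _).add_const _).continuousAt
      ((hcont.mul_const _).add_const _).continuousAt ?_
    have hY : enumCols en (levelState (T := T) δ e L 0) σ t (en (true, .inl q₀)) =
        e (stateSeq δ q₀ σ t) := by
      rw [stateSeq_eq_blockMap δ q₀ σ hT t]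
      simp [enumCols, levelState, coords]
    have hne : (e q : ℝ) - e (stateSeq δ q₀ σ t) ≠ 0 :=
      sub_ne_zero.2 fun h => hq (hinj (by exact_mod_cast h))
    have := pow_pos (abs_pos.2 hne) 2
    rw [sq_abs] at this
    simp only [hY]
    linarith
  obtain ⟨Ls, hlen, hLs⟩ := happrox _ hU
  refine ⟨{ D := 2 * (Fintype.card Q + 4)
            Dk := 2
            Dv := 2 * (Fintype.card Q + 4)
            W := 4 * Fintype.card Q ^ 2 + 2 * Fintype.card Q + 9
            embed := fun a d => if (en.symm d).1
              then Sum.elim (fun q => (e (δ q a) : ℝ)) 0 (en.symm d).2 else 0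
            pos := fun t d => if (en.symm d).1 then
              Sum.elim (fun _ => (0 : ℝ)) ![((t : ℕ) : ℝ), cantorCode L t, 1, 1] (en.symm d).2 else 0
            layers := Ls }, readout e en, rfl, rfl, rfl, rfl, hlen, ?_⟩
  intro q₀ σ t q hq
  have hin : enumCols en (levelState (T := T) δ e 0 L) σ = Matrix.of fun t d =>
      (if (en.symm d).1 then Sum.elim (fun q => (e (δ q (σ t)) : ℝ)) 0 (en.symm d).2 else 0) +
      (if (en.symm d).1 then
        Sum.elim (fun _ => (0 : ℝ)) ![((t : ℕ) : ℝ), cantorCode L t, 1, 1] (en.symm d).2 else 0) := by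
    ext t d
    simp only [enumCols, levelState, Matrix.of_apply]
    split_ifs
    · rcases (en.symm d).2 with q | j
      · simp [coords, blockMap]
      · fin_cases j <;> simp [coords, Nat.mod_one]
    · simp
  have h := hLs q₀ σ t q hq
  simp only [hin] at h
  simp only [Backbone.logits, mul_readout]
  exact h

lemma output_eq_of_logits_lt [Nonempty Q] (M : Backbone Γ T) (c : Classifier M.D Q)
    (σ : Fin T → Γ) (y : Fin T → Q)
    (h : ∀ t q, q ≠ y t → M.logits c σ t q < M.logits c σ t (y t)) : M.output c σ = y := by
  ext t
  by_contra hne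
  exact (h t _ hne).not_ge (Classical.choose_spec (Finite.exists_max (M.logits c σ t)) (y t))

lemma two_mul_clog_le {T : ℕ} (hT : 1 ≤ T) : ((2 * Nat.clog 2 T : ℕ) : ℝ) ≤ 15 * Real.log T := by
  rcases hT.eq_or_lt with rfl | h1
  · simp
  have hlt := Nat.pow_pred_clog_lt_self one_lt_two h1
  have hpos := Nat.clog_pos one_lt_two h1
  have hlog2 := Real.log_two_gt_d9
  have hp : ((2 : ℝ) ^ (Nat.clog 2 T).pred) ≤ T := by exact_mod_cast hlt.le
  have h2 := Real.log_le_log (by positivity) hp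
  rw [Real.log_pow] at h2
  have h3 : Real.log 2 ≤ Real.log T := Real.log_le_log two_pos (by exact_mod_cast h1)
  obtain ⟨n, hn⟩ : ∃ n, Nat.clog 2 T = n + 1 := ⟨_, (Nat.succ_pred_eq_of_pos hpos).symm⟩
  rw [hn] at h2 ⊢
  rw [Nat.pred_succ] at h2
  have hn0 : (0 : ℝ) ≤ n := Nat.cast_nonneg n
  have h4 : (n : ℝ) * (1 / 2) ≤ n * Real.log 2 := mul_le_mul_of_nonneg_left (by linarith) hn0
  push_cast
  linarith

end Simulation

end

end TELM

theorem theorem3 :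
    ∃ (C : ℝ) (S : ℝ → ℕ → ℕ),
      (∀ ε : ℝ, 0 < ε → ε < 1 →
        (∀ T : ℕ, 1 ≤ S ε T) ∧
        (fun T : ℕ => (S ε T : ℝ)) =O[Filter.atTop] (fun T : ℕ => Real.log (T : ℝ))) ∧
      ∀ (T : ℕ), 1 ≤ T →
      ∀ (Γ : Type*) (Q : Type*) [Finite Γ] [Fintype Q] [Nonempty Q] (δ : Q → Γ → Q),
      ∃ (M : TELM.Backbone Γ T) (c : Q → TELM.Classifier M.D Q),
        (M.D : ℝ) ≤ C * (Fintype.card Q : ℝ) ^ 2 ∧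
        (M.W : ℝ) ≤ C * (Fintype.card Q : ℝ) ^ 2 ∧
        (M.Dk : ℝ) ≤ C * (Fintype.card Q : ℝ) ∧
        (M.Dv : ℝ) ≤ C * (Fintype.card Q : ℝ) ∧
        (M.depth : ℝ) ≤ C * Real.log (T : ℝ) ∧
        (∀ (q₀ : Q) (σ : Fin T → Γ) (t : Fin T) (q : Q), q ≠ TELM.stateSeq δ q₀ σ t →
          M.logits (c q₀) σ t q < M.logits (c q₀) σ t (TELM.stateSeq δ q₀ σ t)) ∧
        ∀ ε : ℝ, 0 < ε → ε < 1 →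
        ∀ (m : ℕ) (ρ : Q → Fin m → ℝ) (q₀ q₀' : Q) (σ σ' : Fin T → Γ),
          1 - 2 / (T : ℝ) ^ 2 ≤
            (TELM.gaussianMatrix (S ε T) (Fin T × Fin m)).real
              {R | M.output (c q₀) σ = TELM.stateSeq δ q₀ σ ∧
                M.output (c q₀') σ' = TELM.stateSeq δ q₀' σ' ∧
                (1 - ε) * ‖TELM.seqVector ρ (TELM.stateSeq δ q₀ σ) -
                    TELM.seqVector ρ (TELM.stateSeq δ q₀' σ')‖ ^ 2 ≤
                  ‖TELM.shortcut R (TELM.seqVector ρ (M.output (c q₀) σ)) -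
                    TELM.shortcut R (TELM.seqVector ρ (M.output (c q₀') σ'))‖ ^ 2 ∧
                ‖TELM.shortcut R (TELM.seqVector ρ (M.output (c q₀) σ)) -
                    TELM.shortcut R (TELM.seqVector ρ (M.output (c q₀') σ'))‖ ^ 2 ≤
                  (1 + ε) * ‖TELM.seqVector ρ (TELM.stateSeq δ q₀ σ) -
                    TELM.seqVector ρ (TELM.stateSeq δ q₀' σ')‖ ^ 2} := by
  refine ⟨15, TELM.projDim, fun ε h0 h1 => ⟨fun T => Nat.le_add_left 1 _,
    TELM.projDim_isBigO_log h0 h1⟩, fun T hT Γ Q _ _ _ δ => ?_⟩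
  obtain ⟨M, c, hD, hW, hDk, hDv, hdepth, hlogits⟩ := TELM.exists_backbone_simulating (T := T) δ
  have hn : (1 : ℝ) ≤ Fintype.card Q := by exact_mod_cast Fintype.card_pos
  have hn2 : (Fintype.card Q : ℝ) ≤ (Fintype.card Q : ℝ) ^ 2 := by nlinarith
  refine ⟨M, c, ?_, ?_, ?_, ?_, ?_, hlogits, ?_⟩
  · rw [hD]; push_cast; linarith
  · rw [hW]; push_cast; linarith
  · rw [hDk]; push_cast; linarith
  · rw [hDv]; push_cast; linarith
  · rw [hdepth]; exact TELM.two_mul_clog_le hT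
  · intro ε h0 h1 m ρ q₀ q₀' σ σ'
    have hout : ∀ q₀ σ, M.output (c q₀) σ = TELM.stateSeq δ q₀ σ := fun q₀ σ =>
      TELM.output_eq_of_logits_lt M (c q₀) σ _ fun t q => hlogits q₀ σ t q
    simp only [hout, true_and, TELM.shortcut_sub]
    have h := TELM.measureReal_norm_shortcut_ge (S := TELM.projDim ε T) (Nat.succ_pos _)
      (TELM.seqVector ρ (TELM.stateSeq δ q₀ σ) - TELM.seqVector ρ (TELM.stateSeq δ q₀' σ')) h0 h1
    have h' := TELM.two_mul_exp_projDim_le h0 h1 hT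
    linarith
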